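/- Let $d\in\mathbb N$ and let $\mathcal M_d$ be the set of real $d\times d$ matrices. For a complex $d\times d$ matrix $\mathbf F$ put $\Im\mathbf F=\frac{1}{2\mathrm i}(\mathbf F-\mathbf F^\dagger)$, a Hermitian matrix; $\geq 0$ means positive semi-definite (in particular Hermitian, or real symmetric). A function $\mathbf A:[0,\infty[\,\to\mathcal M_d$ is called a matrix-valued complete Bernstein function if (i) its restriction to $]0,\infty[$ has an analytic continuation $\mathbf A(z)$ to the cut plane $\mathbb C\setminus\,]-\infty,0]$ which satisfies $\Im z\,\Im\mathbf A(z)\geq 0$ there, and (ii) the limit $\lim_{x\to0+}\mathbf A(x)$ exists, equals $\mathbf A(0)$, and is a real positive semi-definite matrix. Theorem. If $\mathbf A$ is a matrix-valued complete Bernstein function, then there are two real positive semi-definite matrices $\mathbf B$ and $\mathbf C$, a positive Radon measure $\mu$ on $]0,\infty[$ with $$\int_{]0,\infty[}\frac{\mu(\mathrm dr)}{1+r}<\infty ,$$ and a measurable function $\mathbf M:\,]0,\infty[\,\to\mathcal M_d$ which is bounded and positive semi-definite $\mu$-almost everywhere, such that $$\mathbf A(x)=\mathbf B+x\,\mathbf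 C+x\int_{]0,\infty[}(x+s)^{-1}\,\mathbf M(s)\,\mu(\mathrm ds)\qquad\text{for all } x\geq 0 .$$ Here the integral converges absolutely for every $x>0$, and at $x=0$ the last term is understood to be $0$. -/

import Mathlib

open MeasureTheory Set Filter Topology

/-- The imaginary part `(B - Bᴴ) / (2 i)` of a complex square matrix; it is always Hermitian. -/
noncomputable def matrixIm {d : ℕ} (B : Matrix (Fin d) (Fin d) ℂ) :
    Matrix (Fin d) (Fin d) ℂ :=
  (1 / (2 * Complex.I)) • (B - B.conjTranspose)

section

open scoped ComplexOrder

/-- Matrix-valued complete Bernstein functions. The function `A` takes real matrices as values and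
is regarded on `[0, ∞[` only; its values at negative arguments play no role. It has an analytic
continuation `F` to the cut plane `ℂ ∖ ]-∞, 0]` (that is, `Complex.slitPlane`) with
`Im z · Im F(z) ≥ 0` there, and its limit at `0+` exists, is the value at `0`, and is a real
positive semi-definite matrix. -/
structure IsMatrixCBF {d : ℕ} (A : ℝ → Matrix (Fin d) (Fin d) ℝ) : Prop where
  exists_continuation : ∃ F : ℂ → Matrix (Fin d) (Fin d) ℂ,
    (∀ i j, AnalyticOnNhd ℂ (fun z => F z i j) Complex.slitPlane) ∧
    (∀ x : ℝ, 0 < x → ∀ i j, F (x : ℂ) i j = ((A x i j : ℝ) : ℂ)) ∧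
    (∀ z ∈ Complex.slitPlane, (z.im • matrixIm (F z)).PosSemidef)
  tendsto_zero : Tendsto A (𝓝[>] 0) (𝓝 (A 0))
  posSemidef_zero : (A 0).PosSemidef

end

/-! For a real vector `v` the form `f = vᵀ F v` preserves the upper and lower half-planes. Pulled
back to the unit disc by `w ↦ ((1 + w)/(1 - w))²`, it has `Im f · Im ζ ≥ 0`. A Cauchy formula
recovers `Re f` on the real diameter from these boundary weights alone (`sub_eq_circleAverage`). In
the coordinate `u = (1 - Re ζ)/2` its kernel becomes `(x - 1)/4 · 1/(1 + u(x - 1))`. The weights on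
circles of radius `r < 1` have bounded mass, so as `r → 1` they converge along an ultrafilter to a
finite measure `ν v` on `[0, 1]` (`exists_representing_measure`).

One ultrafilter serves all `v`, so `ν v` is quadratic in `v`. Polarising the densities of the
measures at `e i + e j` with respect to their sum `τ` gives a bounded matrix density `N`; it is
positive semi-definite almost everywhere because each `ν v` is positive (`exists_matrix_density`).

The finite limit at `0+` makes `1/(1 - u)` integrable by Fatou. This rules out mass at `u = 1` and
allows the base point to be moved from `1` to `0` (`sub_zero_eq_integral`). The atom at `u = 0`
yields the linear term `C`, and `s = 1/u - 1` carries the open interval onto the half-line. -/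

/-- Scalar functions holomorphic on the cut plane, real on the positive half-line, which preserve
the upper and the lower half-plane. -/
structure IsRealPick (f : ℂ → ℂ) : Prop where
  differentiableOn : DifferentiableOn ℂ f Complex.slitPlane
  im_ofReal : ∀ x : ℝ, 0 < x → (f x).im = 0
  im_mul_im_nonneg : ∀ z ∈ Complex.slitPlane, 0 ≤ z.im * (f z).im

/-! ### The disc and the cut plane -/

/-- The conformal map of the unit disc onto the cut plane. -/
noncomputable def discToSlit (w : ℂ) : ℂ := ((1 + w) / (1 - w)) ^ 2

theorem re_cayley_pos {w : ℂ} (hw : ‖w‖ < 1) : 0 < ((1 + w) / (1 - w)).re := by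
  have h1 : (1 - w) ≠ 0 := by
    intro h
    have : w = 1 := by linear_combination -h
    simp [this] at hw
  have h2 : 0 < Complex.normSq (1 - w) := Complex.normSq_pos.mpr h1
  have h3 : Complex.normSq w < 1 := by
    rw [Complex.normSq_eq_norm_sq]
    nlinarith [norm_nonneg w]
  rw [Complex.normSq_apply] at h3
  rw [Complex.div_re, ← add_div]
  apply div_pos _ h2
  simp
  nlinarith

theorem im_cayley {w : ℂ} :
    ((1 + w) / (1 - w)).im = 2 / Complex.normSq (1 - w) * w.im := by
  rw [Complex.div_im, ← sub_div]
  simp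
  ring

/-- The Cayley transform `m` has positive real part and `Im m` is a positive multiple of `Im w`; now
use `Im m² = 2 Re m Im m`. Upper and lower half-discs thus go to upper and lower half-planes. -/
theorem exists_im_discToSlit {w : ℂ} (hw : ‖w‖ < 1) :
    ∃ c > 0, (discToSlit w).im = c * w.im := by
  have h1 : (1 - w) ≠ 0 := by
    intro h
    have : w = 1 := by linear_combination -h
    simp [this] at hw
  have h2 : 0 < Complex.normSq (1 - w) := Complex.normSq_pos.mpr h1
  have h3 := re_cayley_pos hw
  refine ⟨2 * ((1 + w) / (1 - w)).re * (2 / Complex.normSq (1 - w)), by positivity, ?_⟩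
  rw [discToSlit, pow_two, Complex.mul_im, im_cayley]
  ring

theorem discToSlit_mem {w : ℂ} (hw : ‖w‖ < 1) : discToSlit w ∈ Complex.slitPlane := by
  have h3 := re_cayley_pos hw
  rw [Complex.mem_slitPlane_iff, discToSlit]
  set m := (1 + w) / (1 - w)
  by_cases h : m.im = 0
  · left
    rw [pow_two, Complex.mul_re, h]
    nlinarith
  · right
    rw [pow_two, Complex.mul_im]
    have : m.re * m.im ≠ 0 := mul_ne_zero h3.ne' h
    intro h'
    apply this
    linarith

theorem differentiableOn_discToSlit : DifferentiableOn ℂ discToSlit (Metric.ball 0 1) := by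
  unfold discToSlit
  refine DifferentiableOn.pow (DifferentiableOn.div (by fun_prop) (by fun_prop) ?_) _
  intro w hw h
  have : w = 1 := by linear_combination -h
  simp [this] at hw

theorem discToSlit_ofReal (w : ℝ) : discToSlit w = (((1 + w) / (1 - w)) ^ 2 : ℝ) := by
  simp [discToSlit]

/-- For `r < 1` the dilated function is holomorphic beyond the closed unit disc, so Cauchy's formula
needs no boundary regularity of `f`. -/
theorem differentiableOn_comp_discToSlit {f : ℂ → ℂ} (hf : DifferentiableOn ℂ f Complex.slitPlane)
    {r : ℝ} (hr0 : 0 < r) :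
    DifferentiableOn ℂ (fun ζ : ℂ => f (discToSlit (r * ζ))) (Metric.ball 0 r⁻¹) := by
  have hball : ∀ ζ ∈ Metric.ball (0 : ℂ) r⁻¹, ‖(r : ℂ) * ζ‖ < 1 := by
    intro ζ hζ
    rw [mem_ball_zero_iff] at hζ
    rw [norm_mul, Complex.norm_real, Real.norm_of_nonneg hr0.le]
    calc r * ‖ζ‖ < r * r⁻¹ := by gcongr
      _ = 1 := mul_inv_cancel₀ hr0.ne'
  refine DifferentiableOn.comp (t := Complex.slitPlane) hf ?_ ?_
  · refine DifferentiableOn.comp (t := Metric.ball 0 1) differentiableOn_discToSlit (by fun_prop) ?_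
    intro ζ hζ
    simpa using hball ζ hζ
  · intro ζ hζ
    exact discToSlit_mem (hball ζ hζ)

theorem closedBall_subset_ball_inv {r : ℝ} (hr0 : 0 < r) (hr1 : r < 1) :
    Metric.closedBall (0 : ℂ) 1 ⊆ Metric.ball 0 r⁻¹ :=
  Metric.closedBall_subset_ball ((one_lt_inv₀ hr0).mpr hr1)

/-! ### Boundary weights and their pairing with continuous functions -/

/-- The coordinate `(1 - cos θ) / 2` of a point of the unit circle. -/
noncomputable def circleCoord (ζ : ℂ) : unitInterval :=
  Set.projIcc 0 1 zero_le_one ((1 - ζ.re) / 2)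

theorem continuous_circleCoord : Continuous circleCoord := by
  unfold circleCoord
  exact continuous_projIcc.comp (by fun_prop)

theorem coe_circleCoord {ζ : ℂ} (hζ : ‖ζ‖ = 1) : (circleCoord ζ : ℝ) = (1 - ζ.re) / 2 := by
  have := Complex.abs_re_le_norm ζ
  rw [hζ, abs_le] at this
  unfold circleCoord
  rw [Set.projIcc_of_mem]
  constructor <;> linarith

/-- The kernel `u ↦ 1 / (1 + u (x - 1))` on the unit interval. -/
noncomputable def resolventKernel (x : ℝ) (hx : 0 < x) : C(unitInterval, ℝ) where
  toFun u := (1 + u * (x - 1))⁻¹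
  continuous_toFun := by
    refine Continuous.inv₀ (by fun_prop) ?_
    intro u
    have h0 := u.2.1
    have h1 := u.2.2
    apply ne_of_gt
    rcases h0.eq_or_lt with h | h <;> nlinarith

theorem resolvent_denom_pos {x : ℝ} (hx : 0 < x) (u : unitInterval) :
    0 < 1 + (u : ℝ) * (x - 1) := by
  have h0 := u.2.1
  have h1 := u.2.2
  rcases h0.eq_or_lt with h | h <;> nlinarith

/-- The boundary densities `Im f · sin θ` at radius `r`, integrated against `g`. -/
noncomputable def circlePairing (f : ℂ → ℂ) (r : ℝ) (g : C(unitInterval, ℝ)) : ℝ :=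
  Real.circleAverage (fun ζ => (f (discToSlit (r * ζ))).im * (2 * ζ.im * g (circleCoord ζ))) 0 1

theorem circleIntegrable_circlePairing {f : ℂ → ℂ} (hf : DifferentiableOn ℂ f Complex.slitPlane)
    {r : ℝ} (hr0 : 0 < r) (hr1 : r < 1) (g : C(unitInterval, ℝ)) :
    CircleIntegrable
      (fun ζ => (f (discToSlit (r * ζ))).im * (2 * ζ.im * g (circleCoord ζ))) 0 1 := by
  apply ContinuousOn.circleIntegrable zero_le_one
  have h1 : ContinuousOn (fun ζ : ℂ => f (discToSlit (r * ζ))) (Metric.sphere 0 1) :=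
    (differentiableOn_comp_discToSlit hf hr0).continuousOn.mono
      (Metric.sphere_subset_closedBall.trans (closedBall_subset_ball_inv hr0 hr1))
  have h2 : Continuous fun ζ : ℂ => g (circleCoord ζ) :=
    g.continuous.comp continuous_circleCoord
  refine ContinuousOn.mul (Complex.continuous_im.comp_continuousOn h1) ?_
  exact Continuous.continuousOn ((continuous_const.mul Complex.continuous_im).mul h2)

theorem circlePairing_add {f : ℂ → ℂ} (hf : DifferentiableOn ℂ f Complex.slitPlane)
    {r : ℝ} (hr0 : 0 < r) (hr1 : r < 1) (g₁ g₂ : C(unitInterval, ℝ)) :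
    circlePairing f r (g₁ + g₂) = circlePairing f r g₁ + circlePairing f r g₂ := by
  unfold circlePairing
  rw [← Real.circleAverage_fun_add (circleIntegrable_circlePairing hf hr0 hr1 g₁)
    (circleIntegrable_circlePairing hf hr0 hr1 g₂)]
  congr 1
  ext ζ
  simp
  ring

theorem circlePairing_smul (f : ℂ → ℂ) (r c : ℝ) (g : C(unitInterval, ℝ)) :
    circlePairing f r (c • g) = c * circlePairing f r g := by
  unfold circlePairing
  rw [← smul_eq_mul, ← Real.circleAverage_fun_smul]
  congr 1
  ext ζ
  simp
  ring

theorem circlePairing_nonneg {f : ℂ → ℂ} (hf : IsRealPick f)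
    {r : ℝ} (hr0 : 0 < r) (hr1 : r < 1) {g : C(unitInterval, ℝ)} (hg : 0 ≤ g) :
    0 ≤ circlePairing f r g := by
  unfold circlePairing
  apply Real.circleAverage_nonneg_of_nonneg
  intro ζ hζ
  have hζ1 : ‖ζ‖ = 1 := by simpa using hζ
  have hn : ‖(r : ℂ) * ζ‖ < 1 := by
    rw [norm_mul, Complex.norm_real, Real.norm_of_nonneg hr0.le, hζ1]
    linarith
  obtain ⟨c, hc, hi⟩ := exists_im_discToSlit hn
  have h := hf.im_mul_im_nonneg _ (discToSlit_mem hn)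
  rw [hi, Complex.im_ofReal_mul] at h
  have hg' : 0 ≤ g (circleCoord ζ) := hg _
  have h' : 0 ≤ (f (discToSlit (r * ζ))).im * ζ.im := by
    have h2 : 0 ≤ (c * r) * ((f (discToSlit (r * ζ))).im * ζ.im) := by
      linarith
    exact nonneg_of_mul_nonneg_right h2 (by positivity)
  show 0 ≤ _
  have := mul_nonneg h' hg'
  nlinarith

theorem circlePairing_sum {ι : Type*} (s : Finset ι) (c : ι → ℝ) {F : ι → ℂ → ℂ}
    (hF : ∀ i ∈ s, DifferentiableOn ℂ (F i) Complex.slitPlane)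
    {r : ℝ} (hr0 : 0 < r) (hr1 : r < 1) (g : C(unitInterval, ℝ)) :
    circlePairing (fun z => ∑ i ∈ s, (c i : ℂ) * F i z) r g
      = ∑ i ∈ s, c i * circlePairing (F i) r g := by
  unfold circlePairing
  simp only [← smul_eq_mul (a := (c _)), ← Real.circleAverage_fun_smul]
  rw [← Real.circleAverage_fun_sum]
  · congr 1
    ext ζ
    simp [Complex.im_sum, Finset.sum_mul, mul_assoc]
  · intro i hi
    exact (circleIntegrable_circlePairing (hF i hi) hr0 hr1 g).const_smul

/-! ### Cauchy formula and resolvent kernel -/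

/-- Averaging `h` against `ζ/(ζ - w)` gives `h w`, and against `1/(1 - wζ)` gives `h 0`. For real
`w` these kernels are conjugate on the unit circle, so their difference is purely imaginary and the
real part of the average sees only `Im h`. -/
theorem sub_eq_circleAverage {h : ℂ → ℂ} {R : ℝ} (hR : 1 < R)
    (hh : DifferentiableOn ℂ h (Metric.ball 0 R)) {w : ℝ} (hw : |w| < 1) :
    (h w).re - (h 0).re = Real.circleAverage
      (fun ζ => (h ζ).im * (2 * ζ.im * (w / (1 - 2 * w * ζ.re + w ^ 2)))) 0 1 := by
  have hsub : Metric.closedBall (0 : ℂ) 1 ⊆ Metric.ball 0 R := Metric.closedBall_subset_ball hR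
  have hne : ∀ ζ ∈ Metric.closedBall (0 : ℂ) 1, 1 - (w : ℂ) * ζ ≠ 0 := by
    intro ζ hζ h0
    rw [mem_closedBall_zero_iff] at hζ
    have h1 : (w : ℂ) * ζ = 1 := by linear_combination -h0
    have h2 : ‖(w : ℂ) * ζ‖ = 1 := by rw [h1]; simp
    rw [norm_mul, Complex.norm_real, Real.norm_eq_abs] at h2
    nlinarith [abs_nonneg w, norm_nonneg ζ]
  have hdc : DiffContOnCl ℂ h (Metric.ball 0 |1|) := by
    apply DifferentiableOn.diffContOnCl
    rw [abs_one, closure_ball _ one_ne_zero]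
    exact hh.mono hsub
  have hd2 : DiffContOnCl ℂ (fun ζ => (1 - (w : ℂ) * ζ)⁻¹ * h ζ) (Metric.ball 0 |1|) := by
    apply DifferentiableOn.diffContOnCl
    rw [abs_one, closure_ball _ one_ne_zero]
    exact (DifferentiableOn.inv (by fun_prop) hne).mul (hh.mono hsub)
  have e1 := hdc.circleAverage_smul_div (w := (w : ℂ)) (by simpa using hw)
  have e2 := hd2.circleAverage
  simp only [mul_zero, sub_zero, inv_one, one_mul] at e2
  have hcont : ContinuousOn h (Metric.sphere 0 1) :=
    hh.continuousOn.mono (Metric.sphere_subset_closedBall.trans hsub)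
  have hsw : ∀ ζ ∈ Metric.sphere (0 : ℂ) 1, ζ - (w : ℂ) ≠ 0 := by
    intro ζ hζ h0
    have : ζ = w := by linear_combination h0
    rw [mem_sphere_zero_iff_norm, this, Complex.norm_real, Real.norm_eq_abs] at hζ
    linarith
  have i1 : CircleIntegrable (fun ζ => ((ζ - 0) / (ζ - (w : ℂ))) • h ζ) 0 1 := by
    apply ContinuousOn.circleIntegrable zero_le_one
    exact (ContinuousOn.div (by fun_prop) (by fun_prop) hsw).smul hcont
  have i2 : CircleIntegrable (fun ζ => (1 - (w : ℂ) * ζ)⁻¹ * h ζ) 0 1 := by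
    apply ContinuousOn.circleIntegrable zero_le_one
    exact (ContinuousOn.inv₀ (by fun_prop)
      fun ζ hζ => hne ζ (Metric.sphere_subset_closedBall hζ)).mul hcont
  have e3 := Real.circleAverage_fun_sub i1 i2
  rw [e1, e2] at e3
  have e4 := Complex.reCLM.circleAverage_comp_comm (i1.sub i2)
  rw [← Complex.sub_re, ← e3]
  refine Eq.trans e4.symm ?_
  apply Real.circleAverage_congr_sphere
  intro ζ hζ
  rw [abs_one] at hζ
  have hn : ζ.re * ζ.re + ζ.im * ζ.im = 1 := by
    have : ‖ζ‖ = 1 := by simpa using hζ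
    have h2 : Complex.normSq ζ = 1 := by rw [Complex.normSq_eq_norm_sq, this, one_pow]
    rwa [Complex.normSq_apply] at h2
  have hζ0 : ζ ≠ 0 := by
    rintro rfl
    simp at hζ
  have hcc : ζ * (starRingEnd ℂ) ζ = 1 := by
    rw [Complex.mul_conj, Complex.normSq_apply, hn]; simp
  have hre : (ζ.re : ℂ) = (ζ + (starRingEnd ℂ) ζ) / 2 := by
    rw [Complex.re_eq_add_conj]
  have him : (ζ.im : ℂ) = (ζ - (starRingEnd ℂ) ζ) / (2 * Complex.I) := by
    rw [Complex.im_eq_sub_conj]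
  have hD : (0 : ℝ) < 1 - 2 * w * ζ.re + w ^ 2 := by
    have h1 := abs_lt.mp hw
    have h2 : |ζ.re| ≤ 1 := by
      rw [← sq_le_one_iff_abs_le_one]
      nlinarith [mul_self_nonneg ζ.im]
    have h3 := abs_le.mp h2
    rcases le_total 0 w with h | h
    · nlinarith [mul_nonneg h (sub_nonneg.mpr h3.2), mul_pos (sub_pos.mpr h1.2) (sub_pos.mpr h1.2)]
    · nlinarith [mul_nonneg (neg_nonneg.mpr h) (neg_le_iff_add_nonneg.mp h3.1),
        mul_pos (neg_lt_iff_pos_add.mp h1.1) (neg_lt_iff_pos_add.mp h1.1)]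
  -- On the circle `|ζ - w|²` factors this way because `ζ̄ = 1/ζ`.
  have hDc : ((1 - 2 * w * ζ.re + w ^ 2 : ℝ) : ℂ) * ζ = (ζ - w) * (1 - w * ζ) := by
    push_cast
    rw [hre]
    linear_combination (-(w : ℂ)) * hcc
  have key : (ζ - 0) / (ζ - (w : ℂ)) - (1 - (w : ℂ) * ζ)⁻¹
      = ((-(2 * ζ.im * (w / (1 - 2 * w * ζ.re + w ^ 2))) : ℝ) : ℂ) * Complex.I := by
    have a1 := hsw ζ hζ
    have a2 := hne ζ (Metric.sphere_subset_closedBall hζ)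
    have a3 : ((1 - 2 * w * ζ.re + w ^ 2 : ℝ) : ℂ) ≠ 0 := by exact_mod_cast hD.ne'
    have step : (ζ - 0) / (ζ - (w : ℂ)) - (1 - (w : ℂ) * ζ)⁻¹
        = w * (1 - ζ ^ 2) / (((1 - 2 * w * ζ.re + w ^ 2 : ℝ) : ℂ) * ζ) := by
      have a2' : 1 - ζ * (w : ℂ) ≠ 0 := by rwa [mul_comm ζ]
      rw [hDc]
      field_simp
      ring
    rw [step]
    rw [Complex.ofReal_neg, Complex.ofReal_mul, Complex.ofReal_mul, Complex.ofReal_div, him]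
    have hI : Complex.I ≠ 0 := Complex.I_ne_zero
    field_simp
    push_cast
    linear_combination (-2 * w : ℂ) * hcc
  have : ((ζ - 0) / (ζ - (w : ℂ))) • h ζ - (1 - (w : ℂ) * ζ)⁻¹ * h ζ
      = ((-(2 * ζ.im * (w / (1 - 2 * w * ζ.re + w ^ 2))) : ℝ) : ℂ) * (Complex.I * h ζ) := by
    rw [smul_eq_mul, ← sub_mul, key, mul_assoc]
  simp only [Function.comp_apply, Pi.sub_apply, Complex.reCLM_apply]
  rw [this, Complex.re_ofReal_mul]
  simp
  ring

theorem exists_cayley_sq_eq {x : ℝ} (hx : 0 < x) : ∃ w : ℝ, |w| < 1 ∧ ((1 + w) / (1 - w)) ^ 2 = x := by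
  have hs : 0 < √x := Real.sqrt_pos.mpr hx
  refine ⟨(√x - 1) / (√x + 1), ?_, ?_⟩
  · rw [abs_lt, lt_div_iff₀ (by positivity), div_lt_iff₀ (by positivity)]
    constructor <;> linarith
  · have : (1 + (√x - 1) / (√x + 1)) / (1 - (√x - 1) / (√x + 1)) = √x := by
      field_simp
      ring
    rw [this, Real.sq_sqrt hx.le]

/-- With `x = ((1 + w)/(1 - w))²` one has `x - 1 = 4w/(1 - w)²` and `1 + u(x - 1) = (1 - 2w Re ζ +
w²)/(1 - w)²`, which turns the Cauchy kernel into the resolvent kernel. -/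
theorem circlePairing_resolventKernel {f : ℂ → ℂ} (hf : DifferentiableOn ℂ f Complex.slitPlane)
    {r : ℝ} (hr0 : 0 < r) (hr1 : r < 1) {w x : ℝ} (hw : |w| < 1) (hx : 0 < x)
    (hxw : ((1 + w) / (1 - w)) ^ 2 = x) :
    (x - 1) / 4 * circlePairing f r (resolventKernel x hx)
      = (f (discToSlit (r * w))).re - (f 1).re := by
  have h := sub_eq_circleAverage ((one_lt_inv₀ hr0).mpr hr1)
    (differentiableOn_comp_discToSlit hf hr0) hw
  have h1 : discToSlit 0 = 1 := by simp [discToSlit]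
  simp only [mul_zero, h1] at h
  rw [h, circlePairing, ← smul_eq_mul, ← Real.circleAverage_fun_smul]
  apply Real.circleAverage_congr_sphere
  intro ζ hζ
  have hζ1 : ‖ζ‖ = 1 := by simpa using hζ
  have hd := resolvent_denom_pos hx (circleCoord ζ)
  simp only [smul_eq_mul, resolventKernel, ContinuousMap.coe_mk]
  have hw' := abs_lt.mp hw
  have h1w : 1 - w ≠ 0 := by linarith
  rw [coe_circleCoord hζ1] at hd ⊢
  have hx1 : x - 1 = 4 * w / (1 - w) ^ 2 := by
    rw [← hxw]
    field_simp
    ring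
  have hD : 1 + (1 - ζ.re) / 2 * (x - 1) = (1 - 2 * w * ζ.re + w ^ 2) * ((1 - w) ^ 2)⁻¹ := by
    rw [hx1]
    field_simp
    ring
  have hD' : 1 - 2 * w * ζ.re + w ^ 2 ≠ 0 := by
    intro h0
    rw [hD, h0, zero_mul] at hd
    exact lt_irrefl _ hd
  have : (x - 1) / 4 * (1 + (1 - ζ.re) / 2 * (x - 1))⁻¹ = w / (1 - 2 * w * ζ.re + w ^ 2) := by
    rw [hD, hx1]
    field_simp
  rw [← this]
  ring

theorem tendsto_circlePairing_resolventKernel {f : ℂ → ℂ}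
    (hf : DifferentiableOn ℂ f Complex.slitPlane) {x : ℝ} (hx : 0 < x) :
    Tendsto (fun r => (x - 1) / 4 * circlePairing f r (resolventKernel x hx)) (𝓝[<] 1)
      (𝓝 ((f x).re - (f 1).re)) := by
  obtain ⟨w, hw, hxw⟩ := exists_cayley_sq_eq hx
  have hwn : ‖(w : ℂ)‖ < 1 := by simpa using hw
  have hφ : discToSlit w = x := by rw [discToSlit_ofReal, hxw]
  have hmem := discToSlit_mem hwn
  have hc : Tendsto (fun r : ℝ => (f (discToSlit (r * w))).re - (f 1).re) (𝓝[<] 1)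
      (𝓝 ((f x).re - (f 1).re)) := by
    refine Tendsto.sub_const ?_ _
    rw [← hφ]
    have c1 : ContinuousAt f (discToSlit w) :=
      (hf.continuousOn).continuousAt (Complex.isOpen_slitPlane.mem_nhds hmem)
    have c2 : ContinuousAt discToSlit (w : ℂ) :=
      differentiableOn_discToSlit.continuousOn.continuousAt
        (Metric.isOpen_ball.mem_nhds (by simpa using hwn))
    have c3 : Tendsto (fun r : ℝ => (r : ℂ) * w) (𝓝[<] 1) (𝓝 (w : ℂ)) := by
      have : Continuous fun r : ℝ => (r : ℂ) * w := by fun_prop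
      have := (this.tendsto 1).mono_left (nhdsWithin_le_nhds (s := Iio 1))
      simpa using this
    exact (Complex.continuous_re.tendsto _).comp (c1.tendsto.comp (c2.tendsto.comp c3))
  refine hc.congr' ?_
  filter_upwards [Ioo_mem_nhdsLT zero_lt_one] with r hr
  exact (circlePairing_resolventKernel hf hr.1 hr.2 hw hx hxw).symm

/-! ### Compactness and the limiting measure -/

theorem exists_bound_circlePairing_one {f : ℂ → ℂ} (hf : IsRealPick f) :
    ∃ K : ℝ, ∀ᶠ r in 𝓝[<] (1 : ℝ), circlePairing f r 1 ≤ K := by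
  -- Any `x > 1` would do: the kernel is at least `1/x` on `[0, 1]`, so its convergent pairing
  -- controls the total mass. At `x = 9` the prefactor `(x - 1)/4` is `2`.
  have h9 : (0 : ℝ) < 9 := by norm_num
  have ht := tendsto_circlePairing_resolventKernel hf.differentiableOn h9
  refine ⟨9 / 2 * ((f 9).re - (f 1).re + 1), ?_⟩
  filter_upwards [ht.eventually (gt_mem_nhds (lt_add_one _)), Ioo_mem_nhdsLT zero_lt_one] with r h hr
  have hpos : 0 ≤ circlePairing f r (resolventKernel 9 h9 + (-(1 / 9 : ℝ)) • 1) := by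
    apply circlePairing_nonneg hf hr.1 hr.2
    intro u
    have hu := u.2.2
    have := resolvent_denom_pos h9 u
    have : (1 / 9 : ℝ) ≤ (1 + (u : ℝ) * (9 - 1))⁻¹ := by
      rw [one_div]
      exact inv_anti₀ this (by linarith)
    simpa [resolventKernel] using this
  rw [circlePairing_add hf.differentiableOn hr.1 hr.2, circlePairing_smul] at hpos
  norm_num at h
  linarith

open CompactlySupported CompactlySupportedContinuousMap in
-- Bounded mass confines each pairing to a compact interval, so it converges along the ultrafilter;
-- the limit is a positive linear functional, to which Riesz applies. The ultrafilter is an argument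
-- so that different `f` can share it.
theorem exists_representing_measure {f : ℂ → ℂ} (hf : IsRealPick f) (U : Ultrafilter ℝ)
    (hU : (U : Filter ℝ) ≤ 𝓝[<] 1) :
    ∃ ν : Measure unitInterval, IsFiniteMeasure ν ∧ ∀ g : C(unitInterval, ℝ),
      Tendsto (fun r => circlePairing f r g) U (𝓝 (∫ u, g u ∂ν)) := by
  obtain ⟨K, hK⟩ := exists_bound_circlePairing_one hf
  have hI : ∀ᶠ r in (U : Filter ℝ), r ∈ Ioo (0 : ℝ) 1 := hU (Ioo_mem_nhdsLT zero_lt_one)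
  have hmono : ∀ g₁ g₂ : C(unitInterval, ℝ), g₁ ≤ g₂ → ∀ r ∈ Ioo (0 : ℝ) 1,
      circlePairing f r g₁ ≤ circlePairing f r g₂ := by
    intro g₁ g₂ h r hr
    have h1 := circlePairing_nonneg hf hr.1 hr.2 (sub_nonneg.mpr h)
    have h2 := circlePairing_add hf.differentiableOn hr.1 hr.2 g₁ (g₂ - g₁)
    rw [add_sub_cancel] at h2
    linarith
  have hlim : ∀ g : C(unitInterval, ℝ), ∃ l : ℝ, Tendsto (fun r => circlePairing f r g) U (𝓝 l) := by
    intro g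
    have hb : ∀ᶠ r in (U : Filter ℝ), circlePairing f r g ∈ Icc (-‖g‖ * K) (‖g‖ * K) := by
      filter_upwards [hI, hU hK] with r hr hKr
      have a1 : circlePairing f r g ≤ circlePairing f r (‖g‖ • 1) :=
        hmono _ _ (fun u => by simpa using (le_abs_self _).trans (g.norm_coe_le_norm u)) r hr
      have a2 : circlePairing f r ((-‖g‖) • 1) ≤ circlePairing f r g :=
        hmono _ _ (fun u => by simpa using (abs_le.mp (g.norm_coe_le_norm u)).1) r hr
      rw [circlePairing_smul] at a1 a2
      have := mul_le_mul_of_nonneg_left hKr (norm_nonneg g)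
      constructor <;> linarith
    obtain ⟨l, -, hl⟩ := (isCompact_Icc (a := -‖g‖ * K) (b := ‖g‖ * K)).ultrafilter_le_nhds
      (U.map fun r => circlePairing f r g) (by
        rw [le_principal_iff, Ultrafilter.mem_coe, Ultrafilter.mem_map]
        exact hb)
    exact ⟨l, hl⟩
  choose L hL using hlim
  let Λ : C_c(unitInterval, ℝ) →ₚ[ℝ] ℝ :=
  { toFun g := L g.toContinuousMap
    map_add' g g' := by
      refine tendsto_nhds_unique (hL _) (((hL _).add (hL _)).congr' ?_)
      filter_upwards [hI] with r hr
      exact (circlePairing_add hf.differentiableOn hr.1 hr.2 _ _).symm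
    map_smul' c g := by
      refine tendsto_nhds_unique (hL _) (((hL _).const_mul c).congr' ?_)
      filter_upwards with r
      exact (circlePairing_smul _ _ _ _).symm
    monotone' g g' hgg' := by
      refine le_of_tendsto_of_tendsto (hL _) (hL _) ?_
      filter_upwards [hI] with r hr
      exact hmono _ _ hgg' r hr }
  refine ⟨RealRMK.rieszMeasure Λ, inferInstance, fun g => ?_⟩
  let g' : C_c(unitInterval, ℝ) :=
  { toFun := g
    hasCompactSupport' := HasCompactSupport.of_compactSpace _ }
  have := RealRMK.integral_rieszMeasure Λ g'
  have e : ∫ u, g u ∂(RealRMK.rieszMeasure Λ) = L g := this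
  rw [e]
  exact hL g

theorem resolvent_formula {f : ℂ → ℂ} (hf : IsRealPick f) {U : Ultrafilter ℝ}
    (hU : (U : Filter ℝ) ≤ 𝓝[<] 1) {ν : Measure unitInterval}
    (hν : ∀ g : C(unitInterval, ℝ), Tendsto (fun r => circlePairing f r g) U (𝓝 (∫ u, g u ∂ν)))
    {x : ℝ} (hx : 0 < x) :
    (f x).re - (f 1).re = (x - 1) / 4 * ∫ u, (1 + (u : ℝ) * (x - 1))⁻¹ ∂ν :=
  tendsto_nhds_unique
    ((tendsto_circlePairing_resolventKernel hf.differentiableOn hx).mono_left hU)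
    ((hν (resolventKernel x hx)).const_mul _)

/-- If `f` has a finite limit at `0+`, then `1 / (1 - u)` is integrable. -/
theorem lintegral_inv_one_sub_lt_top {f : ℂ → ℂ} {ν : Measure unitInterval} [IsFiniteMeasure ν]
    (h : ∀ x : ℝ, 0 < x →
      (f x).re - (f 1).re = (x - 1) / 4 * ∫ u, (1 + (u : ℝ) * (x - 1))⁻¹ ∂ν)
    {a : ℝ} (ha : Tendsto (fun x : ℝ => (f x).re) (𝓝[>] 0) (𝓝 a)) :
    ∫⁻ u, (ENNReal.ofReal (1 - (u : ℝ)))⁻¹ ∂ν < ⊤ := by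
  have hlim : ∀ u : unitInterval, Tendsto
      (fun x : ℝ => (ENNReal.ofReal (1 + (u : ℝ) * (x - 1)))⁻¹) (𝓝[>] 0)
      (𝓝 (ENNReal.ofReal (1 - (u : ℝ)))⁻¹) := by
    intro u
    have : Continuous fun x : ℝ => (ENNReal.ofReal (1 + (u : ℝ) * (x - 1)))⁻¹ :=
      (ENNReal.continuous_ofReal.comp (by fun_prop)).inv
    have := (this.tendsto 0).mono_left (nhdsWithin_le_nhds (s := Ioi 0))
    convert this using 4
    ring
  calc ∫⁻ u, (ENNReal.ofReal (1 - (u : ℝ)))⁻¹ ∂ν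
      = ∫⁻ u, liminf (fun x : ℝ => (ENNReal.ofReal (1 + (u : ℝ) * (x - 1)))⁻¹) (𝓝[>] 0) ∂ν := by
        congr 1
        ext u
        exact (hlim u).liminf_eq.symm
    _ ≤ liminf (fun x : ℝ => ∫⁻ u, (ENNReal.ofReal (1 + (u : ℝ) * (x - 1)))⁻¹ ∂ν) (𝓝[>] 0) :=
        -- Fatou's lemma; since `0⁻¹ = ⊤` here, finiteness also excludes an atom at `u = 1`.
        lintegral_liminf_le' (fun x => by fun_prop)
    _ = ENNReal.ofReal (4 * ((f 1).re - a)) := by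
        apply Tendsto.liminf_eq
        have ht : Tendsto (fun x : ℝ => ENNReal.ofReal (((f x).re - (f 1).re) / ((x - 1) / 4)))
            (𝓝[>] 0) (𝓝 (ENNReal.ofReal ((a - (f 1).re) / ((0 - 1) / 4)))) := by
          refine (ENNReal.continuous_ofReal.tendsto _).comp ?_
          refine (ha.sub_const _).div ?_ (by norm_num)
          have : Continuous fun x : ℝ => (x - 1) / 4 := by fun_prop
          exact (this.tendsto 0).mono_left nhdsWithin_le_nhds
        have e : (a - (f 1).re) / ((0 - 1) / 4) = 4 * ((f 1).re - a) := by ring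
        rw [e] at ht
        refine ht.congr' ?_
        filter_upwards [Ioo_mem_nhdsGT zero_lt_one] with x hx
        have hx1 : (x - 1) / 4 ≠ 0 := by
          have := hx.2
          intro h0
          linarith
        rw [h x hx.1, mul_div_cancel_left₀ _ hx1]
        rw [ofReal_integral_eq_lintegral_ofReal]
        · congr 1
          ext u
          exact ENNReal.ofReal_inv_of_pos (resolvent_denom_pos hx.1 u)
        · exact ((resolventKernel x hx.1).continuous).integrable_of_hasCompactSupport
            (HasCompactSupport.of_compactSpace _)
        · exact ae_of_all _ fun u => (inv_pos.mpr (resolvent_denom_pos hx.1 u)).le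
    _ < ⊤ := ENNReal.ofReal_lt_top

/-- The hypothesis says `φ τ = ν` as signed measures. Moving the negative part across gives an
identity of finite positive measures, `φ⁻ τ + ν = φ⁺ τ`, so `φ⁻ τ ≤ φ⁺ τ` on every set. -/
theorem ae_nonneg_of_integral_mul_eq {τ ν : Measure unitInterval} [IsFiniteMeasure τ]
    [IsFiniteMeasure ν] {φ : unitInterval → ℝ} (hm : Measurable φ) (hφ : Integrable φ τ)
    (h : ∀ g : C(unitInterval, ℝ), ∫ u, φ u * g u ∂τ = ∫ u, g u ∂ν) : ∀ᵐ u ∂τ, 0 ≤ φ u := by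
  have hfin : ∀ ψ : unitInterval → ℝ, Integrable ψ τ →
      IsFiniteMeasure (τ.withDensity fun u => ENNReal.ofReal (ψ u)) := fun ψ hψ =>
    isFiniteMeasure_withDensity_ofReal hψ.2
  have := hfin φ hφ
  have := hfin (fun u => -φ u) hφ.neg
  have hint : ∀ ψ : unitInterval → ℝ, Measurable ψ → ∀ g : unitInterval → ℝ,
      ∫ u, g u ∂(τ.withDensity fun u => ENNReal.ofReal (ψ u)) = ∫ u, max (ψ u) 0 * g u ∂τ := by
    intro ψ hψ g
    rw [integral_withDensity_eq_integral_toReal_smul (by fun_prop)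
      (ae_of_all _ fun _ => ENNReal.ofReal_lt_top)]
    simp [ENNReal.toReal_ofReal']
  have key : τ.withDensity (fun u => ENNReal.ofReal (-φ u)) + ν
      = τ.withDensity (fun u => ENNReal.ofReal (φ u)) := by
    apply ext_of_forall_integral_eq_of_IsFiniteMeasure
    intro g
    rw [integral_add_measure (g.integrable _) (g.integrable _), hint (fun u => -φ u) hm.neg, hint _ hm,
      show ∫ u, g u ∂ν = ∫ u, φ u * g u ∂τ from (h g.toContinuousMap).symm]
    have hb : ∀ ψ : unitInterval → ℝ, Integrable ψ τ → Integrable (fun u => ψ u * g u) τ := by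
      intro ψ hψ
      exact hψ.mul_bdd (c := ‖g‖) g.continuous.aestronglyMeasurable
        (ae_of_all _ g.norm_coe_le_norm)
    rw [← integral_add (hb (fun u => max (-φ u) 0) hφ.neg.pos_part) (hb _ hφ)]
    congr 1
    ext u
    show max (-φ u) 0 * g u + φ u * g u = _
    rw [← add_mul]
    congr 1
    rcases le_total 0 (φ u) with h0 | h0
    · rw [max_eq_right (by linarith), max_eq_left h0, zero_add]
    · rw [max_eq_left (by linarith), max_eq_right h0]
      ring
  apply ae_nonneg_of_forall_setIntegral_nonneg hφ
  intro s hs _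
  rw [integral_eq_lintegral_pos_part_sub_lintegral_neg_part hφ.integrableOn,
    ← withDensity_apply _ hs, ← withDensity_apply _ hs, sub_nonneg]
  apply ENNReal.toReal_mono (measure_ne_top _ _)
  rw [← key]
  exact Measure.le_iff'.mp (Measure.le_add_right le_rfl) s

/-! ### From matrices to scalar forms and back -/

/-- The quadratic form `vᵀ F(z) v` of a matrix-valued function at a real vector. -/
def quadForm {d : ℕ} (F : ℂ → Matrix (Fin d) (Fin d) ℂ) (v : Fin d → ℝ) (z : ℂ) : ℂ :=
  ∑ p : Fin d × Fin d, ((v p.1 * v p.2 : ℝ) : ℂ) * F z p.1 p.2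

open scoped ComplexOrder in
theorem im_quadForm_eq {d : ℕ} (F : ℂ → Matrix (Fin d) (Fin d) ℂ) (v : Fin d → ℝ) (z : ℂ) :
    (star (fun i => (v i : ℂ)) ⬝ᵥ Matrix.mulVec (matrixIm (F z)) fun i => (v i : ℂ)).re
      = (quadForm F v z).im := by
  have h1 : ∀ i j, (matrixIm (F z) i j).re = ((F z i j).im + (F z j i).im) / 2 := by
    intro i j
    simp [matrixIm]
    ring
  have h2 : (quadForm F v z).im = ∑ i, ∑ j, v i * v j * (F z i j).im := by
    rw [quadForm, Complex.im_sum, Fintype.sum_prod_type]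
    simp [-Complex.ofReal_mul]
  have h3 : (quadForm F v z).im = ∑ i, ∑ j, v i * v j * (F z j i).im := by
    rw [h2, Finset.sum_comm]
    simp only [mul_comm (v _) (v _)]
  have h4 : (star (fun i => (v i : ℂ)) ⬝ᵥ Matrix.mulVec (matrixIm (F z)) fun i => (v i : ℂ)).re
      = ∑ i, ∑ j, v i * v j * (matrixIm (F z) i j).re := by
    simp only [dotProduct, Matrix.mulVec, Finset.mul_sum, Complex.re_sum]
    refine Finset.sum_congr rfl fun i _ => Finset.sum_congr rfl fun j _ => ?_
    simp
    ring
  -- The form at a real vector sees only the symmetric part of `Im F`, so it is averaged with its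
  -- copy under the index swap.
  have h5 : (quadForm F v z).im = ((quadForm F v z).im + (quadForm F v z).im) / 2 := by ring
  rw [h4, h5]
  nth_rewrite 1 [h2]
  rw [h3, ← Finset.sum_add_distrib, Finset.sum_div]
  refine Finset.sum_congr rfl fun i _ => ?_
  rw [← Finset.sum_add_distrib, Finset.sum_div]
  refine Finset.sum_congr rfl fun j _ => ?_
  rw [h1]
  ring

/-- The defining properties of the analytic continuation of a matrix-valued complete Bernstein
function. -/
structure IsMatrixPick {d : ℕ} (A : ℝ → Matrix (Fin d) (Fin d) ℝ)
    (F : ℂ → Matrix (Fin d) (Fin d) ℂ) : Prop where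
  differentiableOn : ∀ i j, DifferentiableOn ℂ (fun z => F z i j) Complex.slitPlane
  eq_ofReal : ∀ x : ℝ, 0 < x → ∀ i j, F (x : ℂ) i j = ((A x i j : ℝ) : ℂ)
  im_nonneg : ∀ v : Fin d → ℝ, ∀ z ∈ Complex.slitPlane, 0 ≤ z.im * (quadForm F v z).im
  symm : ∀ x : ℝ, 0 < x → ∀ i j, A x i j = A x j i

open scoped ComplexOrder in
theorem IsMatrixCBF.exists_isMatrixPick {d : ℕ} {A : ℝ → Matrix (Fin d) (Fin d) ℝ}
    (hA : IsMatrixCBF A) : ∃ F, IsMatrixPick A F := by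
  obtain ⟨F, hF, hFA, hP⟩ := hA.exists_continuation
  refine ⟨F, fun i j => (hF i j).differentiableOn, hFA, ?_, ?_⟩
  · intro v z hz
    have h := (hP z hz).dotProduct_mulVec_nonneg fun i => (v i : ℂ)
    rw [Matrix.smul_mulVec, dotProduct_smul] at h
    have h' := (Complex.le_def.mp h).1
    rw [Complex.real_smul, Complex.re_ofReal_mul, im_quadForm_eq] at h'
    simpa using h'
  · intro x hx i j
    have hx' : (x : ℂ) ∈ Complex.slitPlane := by simp [hx]
    have hc : ∀ i j, ContinuousAt (fun z => F z i j) x := fun i j =>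
      ((hF i j) x hx').continuousAt
    have hcM : ContinuousAt (fun z => matrixIm (F z)) x := by
      refine continuousAt_pi.mpr fun i => continuousAt_pi.mpr fun j => ?_
      have : (fun z => matrixIm (F z) i j)
          = fun z => 1 / (2 * Complex.I) * (F z i j - (starRingEnd ℂ) (F z j i)) := by
        ext z
        simp [matrixIm]
      rw [this]
      exact continuousAt_const.mul
        ((hc i j).sub (Complex.continuous_conj.continuousAt.comp (hc j i)))
    -- Approaching `x` from the upper half-plane makes `Im F(x)` positive semi-definite. Its trace
    -- vanishes because `F(x)` is real, so it is zero, and `A x` is symmetric.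
    have hlim : Tendsto (fun t : ℝ => matrixIm (F (x + t * Complex.I))) (𝓝[>] 0)
        (𝓝 (matrixIm (F x))) := by
      refine hcM.tendsto.comp ?_
      have : Continuous fun t : ℝ => (x : ℂ) + t * Complex.I := by fun_prop
      have := (this.tendsto 0).mono_left (nhdsWithin_le_nhds (s := Ioi 0))
      simpa using this
    have hpsd : (matrixIm (F x)).PosSemidef := by
      rw [Matrix.posSemidef_iff_dotProduct_mulVec]
      constructor
      · ext i j
        simp [matrixIm, Matrix.conjTranspose_apply, hFA x hx]
        ring
      · intro v
        have hv : Continuous fun M : Matrix (Fin d) (Fin d) ℂ => star v ⬝ᵥ (M.mulVec v) := by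
          fun_prop
        refine ge_of_tendsto ((hv.tendsto _).comp hlim) ?_
        filter_upwards [self_mem_nhdsWithin] with t ht
        have ht' : 0 < t := ht
        have hmem : (x : ℂ) + t * Complex.I ∈ Complex.slitPlane := by
          rw [Complex.mem_slitPlane_iff]
          left
          simpa using hx
        have h := (hP _ hmem).dotProduct_mulVec_nonneg v
        have him : ((x : ℂ) + t * Complex.I).im = t := by simp
        rw [him, Matrix.smul_mulVec, dotProduct_smul] at h
        have h2 := smul_nonneg (inv_nonneg.mpr ht'.le) h
        rwa [smul_smul, inv_mul_cancel₀ ht'.ne', one_smul] at h2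
    have hz : matrixIm (F x) = 0 := by
      rw [← hpsd.trace_eq_zero_iff]
      simp [Matrix.trace, matrixIm, hFA x hx]
    have := congrFun (congrFun hz i) j
    simp [matrixIm, hFA x hx, sub_eq_zero] at this
    exact_mod_cast this

theorem IsMatrixPick.isRealPick {d : ℕ} {A : ℝ → Matrix (Fin d) (Fin d) ℝ}
    {F : ℂ → Matrix (Fin d) (Fin d) ℂ} (h : IsMatrixPick A F) (v : Fin d → ℝ) :
    IsRealPick (quadForm F v) where
  differentiableOn := by
    unfold quadForm
    exact DifferentiableOn.fun_sum fun p _ => (h.differentiableOn p.1 p.2).const_mul _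
  im_ofReal x hx := by
    simp [quadForm, Complex.im_sum, h.eq_ofReal x hx]
  im_mul_im_nonneg := h.im_nonneg v

/-- The quadratic form with coefficients `a`. -/
def quadSum {d : ℕ} (a : Fin d → Fin d → ℝ) (v : Fin d → ℝ) : ℝ :=
  ∑ p : Fin d × Fin d, v p.1 * v p.2 * a p.1 p.2

/-- The vector `e i + e j`. -/
def basisPair {d : ℕ} (i j : Fin d) : Fin d → ℝ := Pi.single i 1 + Pi.single j 1

/-- The bilinear form recovered from the values of a quadratic form at the vectors `e i + e j`. -/
noncomputable def polarize {d : ℕ} (q : Fin d → Fin d → ℝ) (i j : Fin d) : ℝ :=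
  (q i j - q i i / 4 - q j j / 4) / 2

theorem basisPair_comm {d : ℕ} (i j : Fin d) : basisPair i j = basisPair j i := add_comm _ _

theorem quadSum_basisPair {d : ℕ} (a : Fin d → Fin d → ℝ) (i j : Fin d) :
    quadSum a (basisPair i j) = a i i + a i j + a j i + a j j := by
  simp only [quadSum, basisPair, Fintype.sum_prod_type, Pi.add_apply, add_mul, mul_add,
    Finset.sum_add_distrib, Pi.single_apply]
  simp
  ring

theorem polarize_quadSum {d : ℕ} (a : Fin d → Fin d → ℝ) (i j : Fin d) :
    polarize (fun i j => quadSum a (basisPair i j)) i j = (a i j + a j i) / 2 := by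
  simp only [polarize, quadSum_basisPair]
  ring

/-- A quadratic form is determined by its values at the vectors `e i + e j`; at `i = j` the vector
is `2 e i`, whence the factors `1/4` in `polarize`. No symmetry of `a` is needed, since only its
symmetric part enters the form. -/
theorem quadSum_polarize_quadSum {d : ℕ} (a : Fin d → Fin d → ℝ) (v : Fin d → ℝ) :
    quadSum (polarize fun i j => quadSum a (basisPair i j)) v = quadSum a v := by
  have h1 : quadSum a v = ∑ p : Fin d × Fin d, v p.1 * v p.2 * a p.2 p.1 := by
    rw [quadSum, ← (Equiv.prodComm (Fin d) (Fin d)).sum_comp]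
    refine Finset.sum_congr rfl fun p _ => ?_
    simp [mul_comm (v p.1)]
  have h2 : quadSum a v = ∑ p : Fin d × Fin d, v p.1 * v p.2 * ((a p.1 p.2 + a p.2 p.1) / 2) := by
    have h3 : quadSum a v = (quadSum a v + ∑ p : Fin d × Fin d, v p.1 * v p.2 * a p.2 p.1) / 2 := by
      rw [← h1]
      ring
    rw [h3, quadSum, ← Finset.sum_add_distrib, Finset.sum_div]
    refine Finset.sum_congr rfl fun p _ => ?_
    ring
  rw [h2, quadSum]
  simp only [polarize_quadSum]

theorem IsMatrixPick.circlePairing_eq {d : ℕ} {A : ℝ → Matrix (Fin d) (Fin d) ℝ}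
    {F : ℂ → Matrix (Fin d) (Fin d) ℂ} (h : IsMatrixPick A F) (v : Fin d → ℝ) {r : ℝ}
    (hr : r ∈ Ioo (0 : ℝ) 1) (g : C(unitInterval, ℝ)) :
    circlePairing (quadForm F v) r g
      = quadSum (fun i j => circlePairing (fun z => F z i j) r g) v := by
  unfold quadForm quadSum
  exact circlePairing_sum Finset.univ (fun p : Fin d × Fin d => v p.1 * v p.2)
    (F := fun p z => F z p.1 p.2) (fun p _ => h.differentiableOn p.1 p.2) hr.1 hr.2 g

theorem IsMatrixPick.re_quadForm_ofReal {d : ℕ} {A : ℝ → Matrix (Fin d) (Fin d) ℝ}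
    {F : ℂ → Matrix (Fin d) (Fin d) ℂ} (h : IsMatrixPick A F) (v : Fin d → ℝ) {x : ℝ}
    (hx : 0 < x) : (quadForm F v x).re = quadSum (fun i j => A x i j) v := by
  simp only [quadForm, quadSum, h.eq_ofReal x hx, Complex.re_sum, ← Complex.ofReal_mul,
    Complex.ofReal_re]

theorem integrable_continuousMap {ν : Measure unitInterval} [IsFiniteMeasure ν]
    (g : C(unitInterval, ℝ)) : Integrable g ν :=
  g.continuous.integrable_of_hasCompactSupport (HasCompactSupport.of_compactSpace _)

theorem integral_polarize {X : Type*} [MeasurableSpace X] {τ : Measure X} {d : ℕ}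
    {h : Fin d → Fin d → X → ℝ} (hh : ∀ i j, Integrable (h i j) τ) (i j : Fin d) :
    ∫ u, polarize (fun i j => h i j u) i j ∂τ = polarize (fun i j => ∫ u, h i j u ∂τ) i j := by
  simp only [polarize]
  rw [integral_div, integral_sub (f := fun u => h i j u - h i i u / 4)
      ((hh i j).sub ((hh i i).div_const 4)) ((hh j j).div_const 4),
    integral_sub (hh i j) ((hh i i).div_const 4), integral_div, integral_div]

theorem integral_quadSum {X : Type*} [MeasurableSpace X] {τ : Measure X} {d : ℕ}
    {h : Fin d → Fin d → X → ℝ} (hh : ∀ i j, Integrable (h i j) τ) (v : Fin d → ℝ) :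
    ∫ u, quadSum (fun i j => h i j u) v ∂τ = quadSum (fun i j => ∫ u, h i j u ∂τ) v := by
  unfold quadSum
  rw [integral_finsetSum _ fun p _ => (hh p.1 p.2).const_mul _]
  simp only [integral_const_mul]

theorem dotProduct_mulVec_eq_quadSum {d : ℕ} (M : Matrix (Fin d) (Fin d) ℝ) (v : Fin d → ℝ) :
    star v ⬝ᵥ M.mulVec v = quadSum M v := by
  simp only [quadSum, Fintype.sum_prod_type, dotProduct, Matrix.mulVec, Finset.mul_sum]
  refine Finset.sum_congr rfl fun i _ => Finset.sum_congr rfl fun j _ => ?_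
  simp
  ring

theorem polarize_mul {d : ℕ} (h : Fin d → Fin d → ℝ) (i j : Fin d) (c : ℝ) :
    polarize h i j * c = polarize (fun i j => h i j * c) i j := by
  unfold polarize
  ring

theorem quadSum_mul {d : ℕ} (h : Fin d → Fin d → ℝ) (v : Fin d → ℝ) (c : ℝ) :
    quadSum h v * c = quadSum (fun i j => h i j * c) v := by
  simp only [quadSum, Finset.sum_mul, mul_assoc]

/-! ### The matrix density on the unit interval -/

/-- A matrix-valued complete Bernstein function is represented by a bounded positive semi-definite
matrix density with respect to a finite measure on the unit interval. -/
theorem exists_matrix_density {d : ℕ} {A : ℝ → Matrix (Fin d) (Fin d) ℝ} (hA : IsMatrixCBF A) :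
    ∃ (τ : Measure unitInterval) (N : unitInterval → Matrix (Fin d) (Fin d) ℝ),
      IsFiniteMeasure τ ∧ (∀ i j, Measurable fun u => N u i j) ∧
      (∀ᵐ u ∂τ, ∀ i j, |N u i j| ≤ 1) ∧ (∀ᵐ u ∂τ, (N u).PosSemidef) ∧
      ∫⁻ u, (ENNReal.ofReal (1 - (u : ℝ)))⁻¹ ∂τ < ⊤ ∧
      ∀ x : ℝ, 0 < x → ∀ i j,
        A x i j - A 1 i j = (x - 1) / 4 * ∫ u, N u i j * (1 + (u : ℝ) * (x - 1))⁻¹ ∂τ := by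
  obtain ⟨F, hF⟩ := hA.exists_isMatrixPick
  set U : Ultrafilter ℝ := Ultrafilter.of (𝓝[<] (1 : ℝ))
  have hU : (U : Filter ℝ) ≤ 𝓝[<] 1 := Ultrafilter.of_le _
  choose ν hνf hν using fun v => exists_representing_measure (hF.isRealPick v) U hU
  have hI : ∀ᶠ r in (U : Filter ℝ), r ∈ Ioo (0 : ℝ) 1 := hU (Ioo_mem_nhdsLT zero_lt_one)
  have hform : ∀ v, ∀ x : ℝ, 0 < x → quadSum (fun i j => A x i j) v - quadSum (fun i j => A 1 i j) v
      = (x - 1) / 4 * ∫ u, (1 + (u : ℝ) * (x - 1))⁻¹ ∂(ν v) := by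
    intro v x hx
    rw [← resolvent_formula (hF.isRealPick v) hU (hν v) hx, hF.re_quadForm_ofReal v hx]
    have := hF.re_quadForm_ofReal v zero_lt_one
    rw [Complex.ofReal_one] at this
    rw [this]
  -- Before the limit the pairings are exactly quadratic in `v`; the common ultrafilter passes this
  -- to the measures.
  have hpol : ∀ v (g : C(unitInterval, ℝ)), ∫ u, g u ∂(ν v)
      = quadSum (polarize fun i j => ∫ u, g u ∂(ν (basisPair i j))) v := by
    intro v g
    refine tendsto_nhds_unique (hν v g) ?_
    have : Tendsto (fun r => quadSum (polarize fun i j =>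
        circlePairing (quadForm F (basisPair i j)) r g) v) U
        (𝓝 (quadSum (polarize fun i j => ∫ u, g u ∂(ν (basisPair i j))) v)) := by
      refine tendsto_finsetSum _ fun p _ => Tendsto.const_mul _ ?_
      exact (((hν _ g).sub ((hν _ g).div_const 4)).sub ((hν _ g).div_const 4)).div_const 2
    refine this.congr' ?_
    filter_upwards [hI] with r hr
    simp only [hF.circlePairing_eq _ hr g]
    exact quadSum_polarize_quadSum _ v
  let τ : Measure unitInterval := ∑ p : Fin d × Fin d, ν (basisPair p.1 p.2)
  have hτf : IsFiniteMeasure τ := by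
    constructor
    simp only [τ, Measure.finsetSum_apply]
    exact ENNReal.sum_lt_top.mpr fun p _ => measure_lt_top _ _
  have hle : ∀ i j, ν (basisPair i j) ≤ τ := fun i j => by
    refine Measure.le_iff'.mpr fun s => ?_
    simp only [τ, Measure.finsetSum_apply]
    exact Finset.single_le_sum (f := fun p : Fin d × Fin d => ν (basisPair p.1 p.2) s)
      (fun _ _ => zero_le) (Finset.mem_univ (i, j))
  have hac : ∀ i j, ν (basisPair i j) ≪ τ := fun i j => (hle i j).absolutelyContinuous
  let h : Fin d → Fin d → unitInterval → ℝ := fun i j u =>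
    ((ν (basisPair i j)).rnDeriv τ u).toReal
  have hm : ∀ i j, Measurable (h i j) := fun i j =>
    (Measure.measurable_rnDeriv _ _).ennreal_toReal
  have hcomm : ∀ i j, h i j = h j i := fun i j => by
    simp only [h, basisPair_comm i j]
  have hint : ∀ i j, Integrable (h i j) τ := fun i j => Measure.integrable_toReal_rnDeriv
  have hmul : ∀ i j (g : C(unitInterval, ℝ)), ∫ u, h i j u * g u ∂τ
      = ∫ u, g u ∂(ν (basisPair i j)) := fun i j g => integral_toReal_rnDeriv_mul (hac i j)
  have hmuli : ∀ i j (g : C(unitInterval, ℝ)), Integrable (fun u => h i j u * g u) τ :=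
    fun i j g => (integrable_toReal_rnDeriv_mul_iff (hac i j)).mpr (integrable_continuousMap g)
  let N : unitInterval → Matrix (Fin d) (Fin d) ℝ := fun u => polarize fun i j => h i j u
  have hNm : ∀ i j, Measurable fun u => N u i j := fun i j =>
    (((hm i j).sub ((hm i i).div_const 4)).sub ((hm j j).div_const 4)).div_const 2
  have hNi : ∀ i j, Integrable (fun u => N u i j) τ := fun i j =>
    (((hint i j).sub ((hint i i).div_const 4)).sub ((hint j j).div_const 4)).div_const 2
  have hNgi : ∀ i j (g : C(unitInterval, ℝ)), Integrable (fun u => N u i j * g u) τ :=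
    fun i j g => (hNi i j).mul_bdd (c := ‖g‖) g.continuous.aestronglyMeasurable
        (ae_of_all _ g.norm_coe_le_norm)
  have hNg : ∀ i j (g : C(unitInterval, ℝ)), ∫ u, N u i j * g u ∂τ
      = polarize (fun i j => ∫ u, g u ∂(ν (basisPair i j))) i j := by
    intro i j g
    simp only [N, polarize_mul]
    rw [integral_polarize (fun i j => hmuli i j g)]
    simp only [hmul]
  have hpos : ∀ v : Fin d → ℝ, ∀ᵐ u ∂τ, 0 ≤ quadSum (N u) v := by
    intro v
    refine ae_nonneg_of_integral_mul_eq (ν := ν v) ?_ ?_ ?_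
    · exact Finset.measurable_sum _ fun p _ => (hNm p.1 p.2).const_mul _
    · exact integrable_finsetSum _ fun p _ => (hNi p.1 p.2).const_mul _
    · intro g
      refine (integral_congr_ae (ae_of_all _ fun u => quadSum_mul (N u) v (g u))).trans ?_
      rw [integral_quadSum fun i j => hNgi i j g, hpol v g]
      simp only [hNg]
  refine ⟨τ, N, hτf, hNm, ?_, ?_, ?_, ?_⟩
  -- Each measure is dominated by the sum `τ`, so its density lies in `[0, 1]`.
  · have h1 : ∀ᵐ u ∂τ, ∀ i j, h i j u ≤ 1 := by
      rw [ae_all_iff]; intro i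
      rw [ae_all_iff]; intro j
      filter_upwards [Measure.rnDeriv_le_one_of_le (hle i j)] with u hu
      exact ENNReal.toReal_le_of_le_ofReal zero_le_one (by simpa using hu)
    filter_upwards [h1] with u hu i j
    have h0 : ∀ i j, 0 ≤ h i j u := fun i j => ENNReal.toReal_nonneg
    simp only [N, polarize, abs_le]
    have := hu i j
    have := hu i i
    have := hu j j
    have := h0 i j
    have := h0 i i
    have := h0 j j
    constructor <;> linarith
  -- The null set depends on `v`; countably many rational vectors share one, and continuity of the
  -- form gives the rest.
  · have hq : ∀ᵐ u ∂τ, ∀ v : Fin d → ℚ, 0 ≤ quadSum (N u) fun i => (v i : ℝ) :=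
      ae_all_iff.mpr fun v => hpos _
    filter_upwards [hq] with u hu
    rw [Matrix.posSemidef_iff_dotProduct_mulVec]
    constructor
    · ext i j
      show polarize (fun i j => h i j u) j i = polarize (fun i j => h i j u) i j
      simp only [polarize, hcomm j i]
      ring
    · intro v
      rw [dotProduct_mulVec_eq_quadSum]
      have hc : Continuous (quadSum (N u)) := by
        unfold quadSum
        fun_prop
      have hd : DenseRange fun w : Fin d → ℚ => fun i => (w i : ℝ) :=
        DenseRange.piMap fun _ => Rat.denseRange_cast
      exact hd.induction_on v (isClosed_Ici.preimage hc) hu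
  · rw [lintegral_finsetSum_measure]
    refine ENNReal.sum_lt_top.mpr fun p _ => ?_
    refine lintegral_inv_one_sub_lt_top (f := quadForm F (basisPair p.1 p.2))
      (a := quadSum (fun i j => A 0 i j) (basisPair p.1 p.2))
      (fun x hx => resolvent_formula (hF.isRealPick _) hU (hν _) hx) ?_
    have hent : ∀ i j, Tendsto (fun x => A x i j) (𝓝[>] 0) (𝓝 (A 0 i j)) := fun i j =>
      tendsto_pi_nhds.mp (tendsto_pi_nhds.mp hA.tendsto_zero i) j
    have : Tendsto (fun x => quadSum (fun i j => A x i j) (basisPair p.1 p.2)) (𝓝[>] 0)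
        (𝓝 (quadSum (fun i j => A 0 i j) (basisPair p.1 p.2))) :=
      tendsto_finsetSum _ fun q _ => (hent q.1 q.2).const_mul _
    refine this.congr' ?_
    filter_upwards [self_mem_nhdsWithin] with x hx
    exact (hF.re_quadForm_ofReal _ hx).symm
  · intro x hx i j
    have e := hNg i j (resolventKernel x hx)
    simp only [resolventKernel, ContinuousMap.coe_mk] at e
    rw [e]
    have hs : ∀ y : ℝ, 0 < y →
        A y i j = polarize (fun i j => quadSum (fun i j => A y i j) (basisPair i j)) i j := by
      intro y hy
      rw [polarize_quadSum, hF.symm y hy j i]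
      ring
    rw [hs x hx, hs 1 zero_lt_one]
    have e2 := fun i j => hform (basisPair i j) x hx
    simp only [polarize]
    linear_combination (e2 i j - e2 i i / 4 - e2 j j / 4) / 2

/-! ### Moving the base point to zero -/

theorem ae_lt_one_of_lintegral {τ : Measure unitInterval}
    (h : ∫⁻ u, (ENNReal.ofReal (1 - (u : ℝ)))⁻¹ ∂τ < ⊤) : ∀ᵐ u : unitInterval ∂τ, (u : ℝ) < 1 := by
  have hm : Measurable fun u : unitInterval => (ENNReal.ofReal (1 - (u : ℝ)))⁻¹ := by fun_prop
  filter_upwards [ae_lt_top hm h.ne] with u hu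
  rw [ENNReal.inv_lt_top, ENNReal.ofReal_pos] at hu
  linarith

theorem integrable_inv_one_sub {τ : Measure unitInterval}
    (h : ∫⁻ u, (ENNReal.ofReal (1 - (u : ℝ)))⁻¹ ∂τ < ⊤) :
    Integrable (fun u : unitInterval => (1 - (u : ℝ))⁻¹) τ := by
  refine ⟨by fun_prop, ?_⟩
  rw [hasFiniteIntegral_iff_ofReal (ae_of_all _ fun u => inv_nonneg.mpr (by linarith [u.2.2]))]
  refine (lintegral_congr_ae ?_).trans_lt h
  filter_upwards [ae_lt_one_of_lintegral h] with u hu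
  exact ENNReal.ofReal_inv_of_pos (by linarith)

/-- The resolvent representation with base point `0` instead of `1`. -/
theorem sub_zero_eq_integral {τ : Measure unitInterval} [IsFiniteMeasure τ]
    (hτ : ∫⁻ u, (ENNReal.ofReal (1 - (u : ℝ)))⁻¹ ∂τ < ⊤) {n : unitInterval → ℝ}
    (hn : Measurable n) (hb : ∀ᵐ u ∂τ, |n u| ≤ 1) {a : ℝ → ℝ}
    (ha : ∀ x : ℝ, 0 < x → a x - a 1 = (x - 1) / 4 * ∫ u, n u * (1 + (u : ℝ) * (x - 1))⁻¹ ∂τ)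
    (ha0 : Tendsto a (𝓝[>] 0) (𝓝 (a 0))) {x : ℝ} (hx : 0 < x) :
    Integrable (fun u : unitInterval => n u * (1 - (u : ℝ))⁻¹ * (1 + (u : ℝ) * (x - 1))⁻¹) τ ∧
    a x - a 0
      = x / 4 * ∫ u, n u * (1 - (u : ℝ))⁻¹ * (1 + (u : ℝ) * (x - 1))⁻¹ ∂τ := by
  have hk := integrable_inv_one_sub hτ
  have hlt := ae_lt_one_of_lintegral hτ
  have hnk : Integrable (fun u : unitInterval => n u * (1 - (u : ℝ))⁻¹) τ :=
    hk.bdd_mul (c := 1) hn.aestronglyMeasurable hb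
  have hbd : ∀ ψ : unitInterval → ℝ, Integrable ψ τ → ∀ y (hy : 0 < y),
      Integrable (fun u : unitInterval => ψ u * (1 + (u : ℝ) * (y - 1))⁻¹) τ := fun ψ hψ y hy =>
    hψ.mul_bdd (c := ‖resolventKernel y hy‖) (resolventKernel y hy).continuous.aestronglyMeasurable
      (ae_of_all _ (resolventKernel y hy).norm_coe_le_norm)
  have hni : Integrable n τ :=
    Integrable.of_bound hn.aestronglyMeasurable 1 hb
  have hlim : Tendsto (fun y : ℝ => ∫ u, n u * (1 + (u : ℝ) * (y - 1))⁻¹ ∂τ) (𝓝[>] 0)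
      (𝓝 (∫ u, n u * (1 - (u : ℝ))⁻¹ ∂τ)) := by
    refine tendsto_integral_filter_of_dominated_convergence (fun u => (1 - (u : ℝ))⁻¹) ?_ ?_ hk ?_
    · exact Eventually.of_forall fun y => by fun_prop
    · filter_upwards [self_mem_nhdsWithin] with y hy
      filter_upwards [hb, hlt] with u hu hu1
      have hy' : 0 < y := hy
      have h1 : 0 < 1 - (u : ℝ) := by linarith
      have h2 : 1 - (u : ℝ) ≤ 1 + (u : ℝ) * (y - 1) := by nlinarith [u.2.1]
      rw [norm_mul, Real.norm_eq_abs, Real.norm_of_nonneg (inv_nonneg.mpr (h1.le.trans h2))]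
      calc |n u| * (1 + (u : ℝ) * (y - 1))⁻¹ ≤ 1 * (1 - (u : ℝ))⁻¹ :=
            mul_le_mul hu (inv_anti₀ h1 h2) (inv_nonneg.mpr (h1.le.trans h2)) zero_le_one
        _ = _ := one_mul _
    · filter_upwards [hlt] with u hu1
      have h1 : 1 - (u : ℝ) ≠ 0 := by linarith
      have hc : ContinuousAt (fun y : ℝ => n u * (1 + (u : ℝ) * (y - 1))⁻¹) 0 := by
        refine continuousAt_const.mul (ContinuousAt.inv₀ (by fun_prop) ?_)
        simpa [← sub_eq_add_neg] using h1
      have := hc.tendsto.mono_left (nhdsWithin_le_nhds (s := Ioi 0))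
      simpa [← sub_eq_add_neg] using this
  have hzero : a 0 - a 1 = (0 - 1) / 4 * ∫ u, n u * (1 - (u : ℝ))⁻¹ ∂τ := by
    refine tendsto_nhds_unique (ha0.sub_const (a 1)) ?_
    have hl : Tendsto (fun y : ℝ => (y - 1) / 4) (𝓝[>] 0) (𝓝 ((0 - 1) / 4)) := by
      have : Continuous fun y : ℝ => (y - 1) / 4 := by fun_prop
      exact (this.tendsto 0).mono_left nhdsWithin_le_nhds
    refine (hl.mul hlim).congr' ?_
    filter_upwards [self_mem_nhdsWithin] with y hy
    exact (ha y hy).symm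
  refine ⟨hbd _ hnk x hx, ?_⟩
  have e : a x - a 0 = (a x - a 1) - (a 0 - a 1) := by ring
  rw [e, ha x hx, hzero, ← integral_const_mul, ← integral_const_mul, ← integral_const_mul,
    ← integral_sub ((hbd _ hni x hx).const_mul _) (hnk.const_mul _)]
  -- The pointwise identity is `(x - 1)/(1 + u(x - 1)) + 1/(1 - u) = x/((1 - u)(1 + u(x - 1)))`.
  refine integral_congr_ae ?_
  filter_upwards [hlt] with u hu1
  have h1 : 1 - (u : ℝ) ≠ 0 := by linarith
  have h2 := (resolvent_denom_pos hx u).ne'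
  generalize hD : 1 + (u : ℝ) * (x - 1) = D at h2
  field_simp
  rw [← hD]
  ring

/-! ### Transport to the half-line -/

/-- The coordinate change `u ↦ 1 / u - 1` from `]0, 1[` onto `]0, ∞[`. -/
noncomputable def toHalfLine (u : unitInterval) : ℝ := (u : ℝ)⁻¹ - 1

/-- The inverse coordinate change `s ↦ 1 / (1 + s)`. -/
noncomputable def ofHalfLine (s : ℝ) : unitInterval := Set.projIcc 0 1 zero_le_one (1 + s)⁻¹

theorem measurable_toHalfLine : Measurable toHalfLine := by
  unfold toHalfLine
  fun_prop

theorem measurable_ofHalfLine : Measurable ofHalfLine := by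
  unfold ofHalfLine
  exact continuous_projIcc.measurable.comp (by fun_prop)

/-- This holds even at `u = 0`: with `0⁻¹ = 0` the point goes to `-1` and back to `0`. -/
theorem ofHalfLine_toHalfLine (u : unitInterval) : ofHalfLine (toHalfLine u) = u := by
  simp only [ofHalfLine, toHalfLine, add_sub_cancel, inv_inv]
  exact Set.projIcc_val _ u

/-- The open unit interval as a subset of the closed one. -/
def openUnit : Set unitInterval := {u | 0 < (u : ℝ) ∧ (u : ℝ) < 1}

theorem measurableSet_openUnit : MeasurableSet openUnit :=
  (measurableSet_lt measurable_const measurable_subtype_coe).inter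
    (measurableSet_lt measurable_subtype_coe measurable_const)

theorem toHalfLine_pos {u : unitInterval} (hu : u ∈ openUnit) : 0 < toHalfLine u := by
  have := (one_lt_inv₀ hu.1).mpr hu.2
  unfold toHalfLine
  linarith

/-- The density `1 / (4 u (1 - u))`. -/
noncomputable def halfLineDensity (u : unitInterval) : ENNReal :=
  ENNReal.ofReal (4 * (u : ℝ) * (1 - u))⁻¹

theorem measurable_halfLineDensity : Measurable halfLineDensity := by
  unfold halfLineDensity
  fun_prop

theorem toReal_halfLineDensity (u : unitInterval) :
    (halfLineDensity u).toReal = (4 * (u : ℝ) * (1 - u))⁻¹ := by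
  have := u.2.1
  have := sub_nonneg.mpr u.2.2
  exact ENNReal.toReal_ofReal (by positivity)

/-- The transport of a measure on `[0, 1]` to the half-line `]0, ∞[`. -/
noncomputable def halfLineMeasure (τ : Measure unitInterval) : Measure ℝ :=
  ((τ.restrict openUnit).withDensity halfLineDensity).map toHalfLine

theorem ae_halfLineMeasure_pos (τ : Measure unitInterval) : ∀ᵐ s ∂(halfLineMeasure τ), s ∈ Ioi 0 := by
  refine (ae_map_iff measurable_toHalfLine.aemeasurable measurableSet_Ioi).mpr ?_
  refine (withDensity_absolutelyContinuous _ _).ae_le ?_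
  filter_upwards [ae_restrict_mem measurableSet_openUnit] with u hu
  exact toHalfLine_pos hu

theorem restrict_halfLineMeasure (τ : Measure unitInterval) :
    (halfLineMeasure τ).restrict (Ioi 0) = halfLineMeasure τ :=
  Measure.restrict_eq_self_of_ae_mem (ae_halfLineMeasure_pos τ)

theorem quasiMeasurePreserving_ofHalfLine (τ : Measure unitInterval) :
    Measure.QuasiMeasurePreserving ofHalfLine (halfLineMeasure τ) τ := by
  refine ⟨measurable_ofHalfLine, ?_⟩
  rw [halfLineMeasure, Measure.map_map measurable_ofHalfLine measurable_toHalfLine]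
  have : ofHalfLine ∘ toHalfLine = id := funext ofHalfLine_toHalfLine
  rw [this, Measure.map_id]
  exact (withDensity_absolutelyContinuous _ _).trans Measure.absolutelyContinuous_restrict

theorem lintegral_halfLineMeasure_lt_top {τ : Measure unitInterval}
    (h : ∫⁻ u, (ENNReal.ofReal (1 - (u : ℝ)))⁻¹ ∂τ < ⊤) :
    ∫⁻ s, ENNReal.ofReal ((1 + s)⁻¹) ∂(halfLineMeasure τ) < ⊤ := by
  have hm : Measurable fun u => ENNReal.ofReal ((1 + toHalfLine u)⁻¹) :=
    ((measurable_toHalfLine.const_add 1).inv).ennreal_ofReal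
  rw [halfLineMeasure, lintegral_map (by fun_prop) measurable_toHalfLine,
    lintegral_withDensity_eq_lintegral_mul _ measurable_halfLineDensity
      (g := fun u => ENNReal.ofReal ((1 + toHalfLine u)⁻¹)) hm]
  refine lt_of_le_of_lt ?_ h
  refine le_trans (setLIntegral_mono' measurableSet_openUnit fun u hu => ?_)
    (setLIntegral_le_lintegral openUnit _)
  have h1 : 0 < 1 - (u : ℝ) := sub_pos.mpr hu.2
  have h0 := hu.1
  simp only [Pi.mul_apply, halfLineDensity, toHalfLine, add_sub_cancel,
    inv_inv]
  rw [← ENNReal.ofReal_mul (by positivity), ← ENNReal.ofReal_inv_of_pos h1]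
  apply ENNReal.ofReal_le_ofReal
  have : (4 * (u : ℝ) * (1 - u))⁻¹ * u = (1 - (u : ℝ))⁻¹ / 4 := by
    field_simp
  rw [this]
  have := inv_pos.mpr h1
  linarith

/-- Markov's inequality: `1/(1 + s)` is bounded below on bounded subsets of the half-line. -/
theorem isLocallyFiniteMeasure_of_lintegral {μ : Measure ℝ} (hpos : ∀ᵐ s ∂μ, s ∈ Ioi 0)
    (h : ∫⁻ s, ENNReal.ofReal ((1 + s)⁻¹) ∂μ < ⊤) : IsLocallyFiniteMeasure μ := by
  refine ⟨fun x => ⟨Iio (|x| + 1), Iio_mem_nhds (by linarith [le_abs_self x]), ?_⟩⟩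
  set R := |x| + 1
  have hR : 0 < 1 + R := by positivity
  have hε : ENNReal.ofReal (1 + R)⁻¹ ≠ 0 := by
    rw [ne_eq, ENNReal.ofReal_eq_zero, not_le]
    positivity
  calc μ (Iio R) ≤ μ {s | ENNReal.ofReal (1 + R)⁻¹ ≤ ENNReal.ofReal ((1 + s)⁻¹)} := by
        refine measure_mono_ae ?_
        filter_upwards [hpos] with s hs hsR
        have hs' : 0 < s := hs
        have hsR' : s < R := hsR
        exact ENNReal.ofReal_le_ofReal (inv_anti₀ (by positivity) (by linarith))
    _ ≤ (∫⁻ s, ENNReal.ofReal ((1 + s)⁻¹) ∂μ) / ENNReal.ofReal (1 + R)⁻¹ :=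
        meas_ge_le_lintegral_div (by fun_prop) hε ENNReal.ofReal_ne_top
    _ < ⊤ := ENNReal.div_lt_top h.ne hε

/-- Since `x + s = (1 + u(x - 1))/u`, the density `1/(4u(1 - u))` absorbs the factor `u` and the
prefactor `1/4`. -/
theorem halfLine_integrand {u : unitInterval} (hu : u ∈ openUnit) {x : ℝ} (hx : 0 < x)
    (n : unitInterval → ℝ) :
    (halfLineDensity u).toReal • ((x + toHalfLine u)⁻¹ * n (ofHalfLine (toHalfLine u)))
      = (n u * (1 - (u : ℝ))⁻¹ * (1 + (u : ℝ) * (x - 1))⁻¹) / 4 := by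
  have h1 : 1 - (u : ℝ) ≠ 0 := (sub_pos.mpr hu.2).ne'
  have h0 := hu.1.ne'
  have h2 := (resolvent_denom_pos hx u).ne'
  have h3 : x + toHalfLine u = (1 + (u : ℝ) * (x - 1)) / u := by
    unfold toHalfLine
    field_simp
    ring
  rw [ofHalfLine_toHalfLine, toReal_halfLineDensity, h3, smul_eq_mul]
  field_simp

theorem integrable_halfLine {τ : Measure unitInterval} {n : unitInterval → ℝ} (hn : Measurable n)
    {x : ℝ} (hx : 0 < x)
    (h : Integrable (fun u : unitInterval => n u * (1 - (u : ℝ))⁻¹ * (1 + (u : ℝ) * (x - 1))⁻¹) τ) :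
    Integrable (fun s => (x + s)⁻¹ * n (ofHalfLine s)) (halfLineMeasure τ) := by
  have hm : Measurable fun s => (x + s)⁻¹ * n (ofHalfLine s) :=
    Measurable.mul (by fun_prop) (hn.comp measurable_ofHalfLine)
  rw [halfLineMeasure, integrable_map_measure hm.aestronglyMeasurable
      measurable_toHalfLine.aemeasurable,
    integrable_withDensity_iff_integrable_smul' measurable_halfLineDensity
      (ae_of_all _ fun _ => ENNReal.ofReal_lt_top)]
  refine (h.restrict.div_const 4).congr ?_
  filter_upwards [ae_restrict_mem measurableSet_openUnit] with u hu
  exact (halfLine_integrand hu hx n).symm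

theorem integral_halfLine {τ : Measure unitInterval} {n : unitInterval → ℝ} (hn : Measurable n)
    {x : ℝ} (hx : 0 < x) :
    ∫ s, (x + s)⁻¹ * n (ofHalfLine s) ∂(halfLineMeasure τ)
      = (∫ u in openUnit, n u * (1 - (u : ℝ))⁻¹ * (1 + (u : ℝ) * (x - 1))⁻¹ ∂τ) / 4 := by
  have hm : Measurable fun s => (x + s)⁻¹ * n (ofHalfLine s) :=
    Measurable.mul (by fun_prop) (hn.comp measurable_ofHalfLine)
  rw [halfLineMeasure, integral_map measurable_toHalfLine.aemeasurable hm.aestronglyMeasurable,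
    integral_withDensity_eq_integral_toReal_smul measurable_halfLineDensity
      (ae_of_all _ fun _ => ENNReal.ofReal_lt_top), ← integral_div]
  refine setIntegral_congr_fun measurableSet_openUnit fun u hu => ?_
  exact halfLine_integrand hu hx n

/-- Only `u = 0`, the image of `s = ∞`, has to be split off; the other endpoint is null by
hypothesis. -/
theorem integral_eq_atom_add_openUnit {τ : Measure unitInterval} (hlt : ∀ᵐ u : unitInterval ∂τ, (u : ℝ) < 1)
    {f : unitInterval → ℝ} (hf : Integrable f τ) :
    ∫ u, f u ∂τ = τ.real {0} * f 0 + ∫ u in openUnit, f u ∂τ := by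
  rw [← integral_add_compl (measurableSet_singleton (0 : unitInterval)) hf, integral_singleton,
    smul_eq_mul]
  congr 2
  refine Measure.restrict_congr_set ?_
  filter_upwards [hlt] with u hu
  refine propext ⟨fun h => ⟨?_, hu⟩, fun h h0 => ?_⟩
  · exact unitInterval.pos_iff_ne_zero.mpr h
  · have h1 := h.1
    rw [show u = 0 from h0] at h1
    exact lt_irrefl _ h1

/-- An almost-everywhere property holds at every point of positive mass; elsewhere the coefficient
is zero. -/
theorem posSemidef_atom {d : ℕ} {τ : Measure unitInterval}
    {N : unitInterval → Matrix (Fin d) (Fin d) ℝ} (hN : ∀ᵐ u ∂τ, (N u).PosSemidef)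
    (u : unitInterval) : (τ.real {u} • N u).PosSemidef := by
  by_cases h : τ {u} = 0
  · rw [measureReal_def, h, ENNReal.toReal_zero, zero_smul]
    exact Matrix.PosSemidef.zero
  · refine Matrix.PosSemidef.smul ?_ measureReal_nonneg
    by_contra h'
    exact h (measure_mono_null (by simpa using h') (ae_iff.mp hN))

/-! ### The representation -/

theorem mainTheorem1 {d : ℕ} (A : ℝ → Matrix (Fin d) (Fin d) ℝ) (hA : IsMatrixCBF A) :
    ∃ (B C : Matrix (Fin d) (Fin d) ℝ) (μ : Measure ℝ) (M : ℝ → Matrix (Fin d) (Fin d) ℝ),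
      B.PosSemidef ∧ C.PosSemidef ∧
      μ.Regular ∧ μ (Iic 0) = 0 ∧
      (∫⁻ r in Ioi (0 : ℝ), ENNReal.ofReal ((1 + r)⁻¹) ∂μ) < ⊤ ∧
      (∀ i j, Measurable (fun s => M s i j)) ∧
      (∃ K : ℝ, ∀ᵐ s ∂μ, ∀ i j, |M s i j| ≤ K) ∧
      (∀ᵐ s ∂μ, (M s).PosSemidef) ∧
      (∀ x : ℝ, 0 < x → ∀ i j,
        IntegrableOn (fun s => (x + s)⁻¹ * M s i j) (Ioi (0 : ℝ)) μ) ∧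
      (∀ x : ℝ, 0 ≤ x → ∀ i j,
        A x i j = B i j + x * C i j
          + x * ∫ s in Ioi (0 : ℝ), (x + s)⁻¹ * M s i j ∂μ) := by
  obtain ⟨τ, N, hτf, hNm, hNb, hNp, hτ, hform⟩ := exists_matrix_density hA
  have hlt := ae_lt_one_of_lintegral hτ
  have hrep : ∀ x : ℝ, 0 < x → ∀ i j, _ := fun x hx i j =>
    sub_zero_eq_integral hτ (hNm i j) (hNb.mono fun u hu => hu i j) (a := fun x => A x i j)
      (fun y hy => hform y hy i j)
      (tendsto_pi_nhds.mp (tendsto_pi_nhds.mp hA.tendsto_zero i) j) hx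
  have hfin := lintegral_halfLineMeasure_lt_top hτ
  have hloc := isLocallyFiniteMeasure_of_lintegral (ae_halfLineMeasure_pos τ) hfin
  have hq := quasiMeasurePreserving_ofHalfLine τ
  -- At `u = 0` the factors `1/(1 - u)` and `1/(1 + u(x - 1))` equal `1`, so the atom contributes
  -- `x/4 · τ{0} N(0)`, which is `x C`.
  refine ⟨A 0, (4⁻¹ : ℝ) • (τ.real {0} • N 0), halfLineMeasure τ, fun s => N (ofHalfLine s),
    hA.posSemidef_zero, (posSemidef_atom hNp 0).smul (by norm_num), inferInstance, ?_, ?_,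
    fun i j => (hNm i j).comp measurable_ofHalfLine, ⟨1, hq.ae hNb⟩, hq.ae hNp, ?_, ?_⟩
  · rw [← compl_Ioi]
    exact mem_ae_iff.mp (ae_halfLineMeasure_pos τ)
  · rwa [restrict_halfLineMeasure]
  · intro x hx i j
    rw [IntegrableOn, restrict_halfLineMeasure]
    exact integrable_halfLine (hNm i j) hx (hrep x hx i j).1
  · intro x hx i j
    rcases hx.eq_or_lt with rfl | hx
    · simp
    · obtain ⟨h1, h2⟩ := hrep x hx i j
      rw [restrict_halfLineMeasure, integral_halfLine (hNm i j) hx]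
      rw [integral_eq_atom_add_openUnit hlt h1] at h2
      simp only [Matrix.smul_apply, smul_eq_mul]
      simp at h2
      linear_combination h2
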